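/- Let $d\ge 2$ and let $G$ be the group of all isometries (if $d=2$), respectively of orientation preserving isometries (if $d\ge 3$), of hyperbolic $d$-space $X$, realised as a group of Lorentz matrices acting on the upper sheet of the hyperboloid in $\mathbb R^{d,1}$, with Lie algebra $\mathfrak g_{\mathbb R}=\mathfrak{so}(d,1)$. Let $K$ be the stabiliser of the base point $(0,\dots,0,1)$. Let $\mathfrak a_{\mathbb R}=\mathbb R H_1\subset\mathfrak g_{\mathbb R}$ be the line spanned by the infinitesimal unit-speed translation $H_1$ along a geodesic through the base point, $A=\exp(\mathfrak a_{\mathbb R})$, $M$ the centraliser of $A$ in $K$, $\mathfrak n_{\mathbb R}=\{Y\in\mathfrak g_{\mathbb R}:[H_1,Y]=Y\}$, $N=\exp(\mathfrak n_{\mathbb R})$ and $P=MAN$. Let $\mathfrak a^*$ be the space of $\mathbb R$-linear maps $\lambda:\mathfrak a_{\mathbb R}\to\mathbb C$, put $a^\lambda=e^{\lambda(\log a)}$ for $a\in A$, and let $\rho\in\mathfrak a^*$ be given by $a^{2\rho}=\det(\mathrm{Ad}(a)|_{\mathfrak n_{\mathbb R}})$. Real functionals on $\mathfrak a_{\mathbb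 R}$ are ordered so that $t\rho>0\Leftrightarrow t>0$. Let $\gamma\in G$ be hyperbolic, i.e. conjugate in $G$ to $a_\gamma m_\gamma$ with $a_\gamma\in A$, $a_\gamma\neq 1$, $m_\gamma\in M$, and let $\lambda_\gamma\in\mathfrak a^*$ be the element with $\lambda_\gamma(\log a_\gamma)=2\pi i$. Let $w_0\in K$ represent the non-trivial element of the Weyl group $N_K(A)/Z_K(A)$ and let $n_0\in N$, $n_0\ne 1$. Let $(\sigma,V_\sigma)$ be a finite dimensional irreducible continuous complex representation of $M$ and let $\lambda\in\mathfrak a^*$ with $\mathrm{Re}(\lambda)>-\rho$. Let $V_{\sigma,\lambda}^\infty$ be the space of smooth functions $f:G\to V_\sigma$ with $f(manx)=a^{\lambda+\rho}\sigma(m)f(x)$ for all $m\in M$, $a\in A$, $n\in N$, $x\in G$, on which $G$ acts by right translation, and let $(V_{\sigma,\lambda}^\infty)^M$ be its subspace of $M$-invariants. Then for every $l\in V_\sigma^*$ and every $f\in (V_{\sigma,\lambda}^\infty)^M$ the integrals $$I_{k,l}^{\sigma,\lambda}(f)=\int_A l(f(w_0n_0a))\,a^{-k\lambda_\gamma}\,da=\int_{\mathbb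 R} l\big(f(w_0n_0\exp(tH_1))\big)\,e^{-k\lambda_\gamma(tH_1)}\,dt\qquad(k\in\mathbb Z)$$ converge absolutely, and the sequence $\big(I_{k,l}^{\sigma,\lambda}(f)\big)_{k\in\mathbb Z}$ is rapidly decreasing: for every $N\in\mathbb N$ one has $|I_{k,l}^{\sigma,\lambda}(f)|=O(|k|^{-N})$ as $|k|\to\infty$. -/

import Mathlib

open scoped Matrix ContDiff

noncomputable section

namespace HypFourier

lemma exp_semiconj {n : Type*} [Fintype n] [DecidableEq n] {Y P Q : Matrix n n ℝ}
    (h : SemiconjBy Y P Q) : NormedSpace.exp Q * Y = Y * NormedSpace.exp P := by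
  open scoped Matrix.Norms.Operator in
  exact h.exp_right.symm

attribute [local instance] Matrix.normedAddCommGroup Matrix.normedSpace

/-- Real square matrices of size `d + 1`; the last index is the time-like one. -/
abbrev Mat (d : ℕ) := Matrix (Fin d ⊕ Unit) (Fin d ⊕ Unit) ℝ

/-- The matrix `diag(1, …, 1, -1)` of the Lorentz form. -/
abbrev J (d : ℕ) : Mat d := LieAlgebra.Orthogonal.indefiniteDiagonal (Fin d) Unit ℝ

lemma J_mul_J (d : ℕ) : J d * J d = 1 := by
  rw [J, LieAlgebra.Orthogonal.indefiniteDiagonal, Matrix.diagonal_mul_diagonal,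
    ← Matrix.diagonal_one]
  congr 1
  ext i
  rcases i with i | i <;> simp

lemma J_transpose (d : ℕ) : (J d)ᵀ = J d := by
  simp [J, LieAlgebra.Orthogonal.indefiniteDiagonal]

lemma lorentz_transpose {d : ℕ} {g : Mat d} (hg : gᵀ * J d * g = J d) :
    g * J d * gᵀ = J d := by
  have h1 : (J d * gᵀ * J d) * g = 1 := by
    rw [Matrix.mul_assoc, Matrix.mul_assoc, ← Matrix.mul_assoc gᵀ, hg, J_mul_J]
  have h2 : g * (J d * gᵀ * J d) = 1 := mul_eq_one_comm.mp h1
  calc g * J d * gᵀ = (g * (J d * gᵀ * J d)) * J d := by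
        simp only [Matrix.mul_assoc, J_mul_J, Matrix.mul_one]
    _ = J d := by rw [h2, Matrix.one_mul]

lemma lorentz_col {d : ℕ} {g : Mat d} (hg : gᵀ * J d * g = J d) :
    ∑ i, g (Sum.inl i) (Sum.inr ()) ^ 2 = g (Sum.inr ()) (Sum.inr ()) ^ 2 - 1 := by
  have h := congrFun (congrFun hg (Sum.inr ())) (Sum.inr ())
  simp [J, LieAlgebra.Orthogonal.indefiniteDiagonal, Matrix.mul_apply,
    Matrix.diagonal_apply] at h
  have h3 : ∀ i, g (Sum.inl i) (Sum.inr ()) ^ 2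
      = g (Sum.inl i) (Sum.inr ()) * g (Sum.inl i) (Sum.inr ()) := fun i => pow_two _
  simp only [h3]
  linarith [h]

lemma lorentz_time_mul {d : ℕ} {g h : Mat d} (hg : gᵀ * J d * g = J d)
    (hh : hᵀ * J d * h = J d)
    (pos : 0 < g (Sum.inr ()) (Sum.inr ()) * h (Sum.inr ()) (Sum.inr ())) :
    0 < (g * h) (Sum.inr ()) (Sum.inr ()) := by
  have hg' : gᵀᵀ * J d * gᵀ = J d := by
    rw [Matrix.transpose_transpose]; exact lorentz_transpose hg
  have e1 := lorentz_col hg'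
  have e2 := lorentz_col hh
  simp only [Matrix.transpose_apply] at e1
  have cs := Finset.sum_mul_sq_le_sq_mul_sq Finset.univ
    (fun i => g (Sum.inr ()) (Sum.inl i)) (fun i => h (Sum.inl i) (Sum.inr ()))
  rw [e1, e2] at cs
  have n1 : 0 ≤ g (Sum.inr ()) (Sum.inr ()) ^ 2 - 1 := e1 ▸ Finset.sum_nonneg fun i _ => sq_nonneg _
  have n2 : 0 ≤ h (Sum.inr ()) (Sum.inr ()) ^ 2 - 1 := e2 ▸ Finset.sum_nonneg fun i _ => sq_nonneg _
  rw [Matrix.mul_apply, Fintype.sum_sum_type]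
  simp only [Finset.univ_unique, PUnit.default_eq_unit, Finset.sum_singleton]
  nlinarith

lemma lorentz_mul {d : ℕ} {g h : Mat d} (hg : gᵀ * J d * g = J d)
    (hh : hᵀ * J d * h = J d) : (g * h)ᵀ * J d * (g * h) = J d := by
  rw [Matrix.transpose_mul]
  calc hᵀ * gᵀ * J d * (g * h) = hᵀ * (gᵀ * J d * g) * h := by simp only [Matrix.mul_assoc]
    _ = J d := by rw [hg, hh]

lemma lorentz_inv {d : ℕ} (g : GL (Fin d ⊕ Unit) ℝ) (hg : (g : Mat d)ᵀ * J d * g = J d) :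
    ((g⁻¹ : GL (Fin d ⊕ Unit) ℝ) : Mat d) = J d * (g : Mat d)ᵀ * J d := by
  have h1 : (J d * (g : Mat d)ᵀ * J d) * g = 1 := by
    rw [Matrix.mul_assoc, Matrix.mul_assoc, ← Matrix.mul_assoc (g : Mat d)ᵀ, hg, J_mul_J]
  exact ((Units.eq_inv_of_mul_eq_one_right h1).symm)

/-- The group `G` acting on hyperbolic `d`-space (the upper sheet of the hyperboloid): all
isometries if `d = 2`, and the orientation preserving ones, i.e. `SO(d,1)⁰`, otherwise. -/
def G (d : ℕ) : Subgroup (GL (Fin d ⊕ Unit) ℝ) where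
  carrier := {g | (g : Mat d)ᵀ * J d * g = J d ∧ 0 < (g : Mat d) (Sum.inr ()) (Sum.inr ()) ∧
    (d = 2 ∨ (g : Mat d).det = 1)}
  mul_mem' := by
    rintro g h ⟨hg, pg, dg⟩ ⟨hh, ph, dh⟩
    refine ⟨?_, ?_, ?_⟩
    · rw [Units.val_mul]; exact lorentz_mul hg hh
    · rw [Units.val_mul]; exact lorentz_time_mul hg hh (mul_pos pg ph)
    · rcases dg with dg | dg
      · exact Or.inl dg
      rcases dh with dh | dh
      · exact Or.inl dh
      · right; rw [Units.val_mul, Matrix.det_mul, dg, dh, one_mul]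
  one_mem' := by
    refine ⟨by simp, by simp, by simp⟩
  inv_mem' := by
    rintro g ⟨hg, pg, dg⟩
    have hi := lorentz_inv g hg
    refine ⟨?_, ?_, ?_⟩
    · rw [hi]
      have := lorentz_transpose hg
      simp only [Matrix.transpose_mul, Matrix.transpose_transpose, J_transpose]
      calc J d * ((g : Mat d) * J d) * J d * (J d * (g : Mat d)ᵀ * J d)
          = J d * ((g : Mat d) * ((J d * (J d * J d)) * (g : Mat d)ᵀ)) * J d := by
            simp only [Matrix.mul_assoc]
        _ = J d * ((g : Mat d) * J d * (g : Mat d)ᵀ) * J d := by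
            rw [J_mul_J, Matrix.mul_one, Matrix.mul_assoc (g : Mat d)]
        _ = J d := by rw [this, J_mul_J, Matrix.one_mul]
    · rw [hi]
      simpa [J, LieAlgebra.Orthogonal.indefiniteDiagonal] using pg
    · rcases dg with dg | dg
      · exact Or.inl dg
      · right
        have h1 : ((g⁻¹ * g : GL (Fin d ⊕ Unit) ℝ) : Mat d).det = 1 := by simp
        rw [Units.val_mul, Matrix.det_mul, dg, mul_one] at h1
        exact h1

instance (d : ℕ) : CoeOut (G d) (Mat d) := ⟨fun g => ((g : GL (Fin d ⊕ Unit) ℝ) : Mat d)⟩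

/-- The real Lie algebra `𝔰𝔬(d,1)` of `G`. -/
abbrev lieG (d : ℕ) : Submodule ℝ (Mat d) := skewAdjointMatricesSubmodule (J d)

lemma mem_lieG {d : ℕ} {X : Mat d} : X ∈ lieG d ↔ Xᵀ * J d = J d * (-X) := by
  rw [lieG, mem_skewAdjointMatricesSubmodule]
  rfl

lemma exp_lorentz {d : ℕ} {X : Mat d} (hX : X ∈ lieG d) :
    (NormedSpace.exp X)ᵀ * J d * NormedSpace.exp X = J d := by
  have hJ : IsUnit (J d) := IsUnit.of_mul_eq_one _ (J_mul_J d)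
  have hJi : (J d)⁻¹ = J d := Matrix.inv_eq_right_inv (J_mul_J d)
  have h1 : Xᵀ = J d * (-X) * (J d)⁻¹ := by
    rw [← mem_lieG.mp hX, hJi, Matrix.mul_assoc, J_mul_J, Matrix.mul_one]
  rw [← Matrix.exp_transpose, h1, Matrix.exp_conj _ _ hJ, hJi,
    Matrix.mul_assoc (J d * NormedSpace.exp (-X)), J_mul_J, Matrix.mul_one, Matrix.mul_assoc,
    ← Matrix.exp_add_of_commute _ _ (by simp)]
  simp

lemma exp_half {d : ℕ} (X : Mat d) :
    NormedSpace.exp X = NormedSpace.exp ((1 / 2 : ℝ) • X) * NormedSpace.exp ((1 / 2 : ℝ) • X) := by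
  rw [← Matrix.exp_add_of_commute _ _ (Commute.refl _), ← add_smul]
  norm_num

lemma lorentz_time_ne {d : ℕ} {g : Mat d} (hg : gᵀ * J d * g = J d) :
    g (Sum.inr ()) (Sum.inr ()) ≠ 0 := by
  intro h0
  have e := lorentz_col hg
  have : 0 ≤ g (Sum.inr ()) (Sum.inr ()) ^ 2 - 1 :=
    e ▸ Finset.sum_nonneg fun i _ => sq_nonneg _
  rw [h0] at this
  norm_num at this

lemma lorentz_det_sq {d : ℕ} {g : Mat d} (hg : gᵀ * J d * g = J d) : g.det * g.det = 1 := by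
  have h := congrArg Matrix.det hg
  have hJ : (J d).det * (J d).det = 1 := by rw [← Matrix.det_mul, J_mul_J, Matrix.det_one]
  have hJ0 : (J d).det ≠ 0 := by
    intro h0
    rw [h0, mul_zero] at hJ
    exact zero_ne_one hJ
  rw [Matrix.det_mul, Matrix.det_mul, Matrix.det_transpose] at h
  apply mul_left_cancel₀ hJ0
  linarith

/-- The exponential map from the Lie algebra of `G` to `G`. -/
def expG {d : ℕ} (X : lieG d) : G d :=
  ⟨⟨NormedSpace.exp (X : Mat d), NormedSpace.exp (-(X : Mat d)),
      by rw [← Matrix.exp_add_of_commute _ _ (by simp)]; simp,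
      by rw [← Matrix.exp_add_of_commute _ _ (by simp)]; simp⟩, by
    have hh : ((1 / 2 : ℝ) • (X : Mat d)) ∈ lieG d := (lieG d).smul_mem _ X.2
    have hE := exp_lorentz hh
    refine ⟨exp_lorentz X.2, ?_, Or.inr ?_⟩
    · show 0 < (NormedSpace.exp (X : Mat d)) _ _
      rw [exp_half]
      exact lorentz_time_mul hE hE (mul_self_pos.mpr (lorentz_time_ne hE))
    · show (NormedSpace.exp (X : Mat d)).det = 1
      rw [exp_half, Matrix.det_mul]
      exact lorentz_det_sq hE⟩

/-- The stabiliser `K` in `G` of the base point `(0, …, 0, 1)` of hyperbolic space. -/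
def K (d : ℕ) : Subgroup (G d) where
  carrier := {g | (g : Mat d) *ᵥ Pi.single (Sum.inr ()) 1 = Pi.single (Sum.inr ()) 1}
  mul_mem' := by
    intro g h hg hh
    simp only [Set.mem_ofPred_eq, Subgroup.coe_mul, Units.val_mul] at *
    rw [← Matrix.mulVec_mulVec, hh, hg]
  one_mem' := Matrix.one_mulVec _
  inv_mem' := by
    intro g hg
    simp only [Set.mem_ofPred_eq] at *
    conv_lhs => rw [← hg]
    rw [Matrix.mulVec_mulVec, ← Units.val_mul, ← Subgroup.coe_mul, inv_mul_cancel]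
    exact Matrix.one_mulVec _

/-- The element `H₁` of `𝔭` determined by the vector `u`: the infinitesimal translation along the
geodesic through the base point with direction `u`. -/
def H {d : ℕ} (u : Fin d → ℝ) : Mat d :=
  Matrix.fromBlocks 0 (Matrix.replicateCol Unit u) (Matrix.replicateRow Unit u) 0

lemma H_mem {d : ℕ} (u : Fin d → ℝ) : H u ∈ lieG d := by
  rw [mem_lieG]
  ext i j
  rcases i with i | i <;> rcases j with j | j <;>
  simp [H, J, LieAlgebra.Orthogonal.indefiniteDiagonal]

/-- `𝔞 = ℝ H₁`. -/
def lieA {d : ℕ} (u : Fin d → ℝ) : Submodule ℝ (Mat d) := ℝ ∙ H u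

lemma lieA_le {d : ℕ} (u : Fin d → ℝ) {X : Mat d} (hX : X ∈ lieA u) : X ∈ lieG d := by
  obtain ⟨c, rfl⟩ := Submodule.mem_span_singleton.mp hX
  exact (lieG d).smul_mem c (H_mem u)

/-- `exp : 𝔞 → G`. -/
def expA {d : ℕ} {u : Fin d → ℝ} (X : lieA u) : G d := expG ⟨X, lieA_le u X.2⟩

/-- The generator `H₁` as an element of `𝔞`. -/
def H₁ {d : ℕ} (u : Fin d → ℝ) : lieA u := ⟨H u, Submodule.mem_span_singleton_self _⟩

lemma lieA_commute {d : ℕ} {u : Fin d → ℝ} (X Y : lieA u) : Commute (X : Mat d) (Y : Mat d) := by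
  obtain ⟨c, hc⟩ := Submodule.mem_span_singleton.mp X.2
  obtain ⟨e, he⟩ := Submodule.mem_span_singleton.mp Y.2
  rw [← hc, ← he]
  exact ((Commute.refl (H u)).smul_left c).smul_right e

lemma expA_add {d : ℕ} {u : Fin d → ℝ} (X Y : lieA u) : expA (X + Y) = expA X * expA Y := by
  apply Subtype.ext
  apply Units.ext
  exact Matrix.exp_add_of_commute (X : Mat d) (Y : Mat d) (lieA_commute X Y)

lemma expA_zero {d : ℕ} {u : Fin d → ℝ} : expA (0 : lieA u) = 1 := by
  have h := expA_add (0 : lieA u) 0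
  rw [add_zero] at h
  exact left_eq_mul.mp h

/-- `A = exp 𝔞`. -/
def A {d : ℕ} (u : Fin d → ℝ) : Subgroup (G d) where
  carrier := Set.range (expA (u := u))
  mul_mem' := by
    rintro _ _ ⟨X, rfl⟩ ⟨Y, rfl⟩
    exact ⟨X + Y, expA_add X Y⟩
  one_mem' := ⟨0, expA_zero⟩
  inv_mem' := by
    rintro _ ⟨X, rfl⟩
    refine ⟨-X, ?_⟩
    rw [eq_inv_iff_mul_eq_one, ← expA_add, neg_add_cancel, expA_zero]

/-- `M`, the centraliser of `A` in `K`. -/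
def M {d : ℕ} (u : Fin d → ℝ) : Subgroup (G d) := Subgroup.centralizer (A u : Set (G d)) ⊓ K d

/-- `𝔫`, the root space in `𝔤` of the root `α` with `α(H₁) = 1`. -/
def lieN {d : ℕ} (u : Fin d → ℝ) : Submodule ℝ (Mat d) where
  carrier := {Y | Y ∈ lieG d ∧ H u * Y - Y * H u = Y}
  add_mem' := by
    rintro X Y ⟨hX, eX⟩ ⟨hY, eY⟩
    refine ⟨(lieG d).add_mem hX hY, ?_⟩
    nth_rewrite 3 [← eX]
    nth_rewrite 3 [← eY]
    noncomm_ring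
  zero_mem' := ⟨(lieG d).zero_mem, by simp⟩
  smul_mem' := by
    rintro c X ⟨hX, eX⟩
    refine ⟨(lieG d).smul_mem c hX, ?_⟩
    rw [Matrix.mul_smul, Matrix.smul_mul, ← smul_sub, eX]

/-- `N = exp 𝔫`. -/
def N {d : ℕ} (u : Fin d → ℝ) : Set (G d) := {n | ∃ Y : lieG d, (Y : Mat d) ∈ lieN u ∧ n = expG Y}

/-- The commutator with `X ∈ 𝔞`, as an endomorphism of `𝔫`. -/
def adN {d : ℕ} (u : Fin d → ℝ) : lieA u →ₗ[ℝ] Module.End ℝ (lieN u) where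
  toFun X :=
    { toFun := fun Y => ⟨(X : Mat d) * Y - Y * X, by
        obtain ⟨c, hc⟩ := Submodule.mem_span_singleton.mp X.2
        have h : (X : Mat d) * Y - Y * X = c • (Y : Mat d) := by
          rw [← hc, Matrix.smul_mul, Matrix.mul_smul, ← smul_sub, Y.2.2]
        rw [h]
        exact (lieN u).smul_mem c Y.2⟩
      map_add' := fun Y Z => Subtype.ext (by
        simp only [Submodule.coe_add]; noncomm_ring)
      map_smul' := fun c Y => Subtype.ext (by
        simp [smul_sub]) }
  map_add' X Y := LinearMap.ext fun Z => Subtype.ext (by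
    simp; noncomm_ring)
  map_smul' c X := LinearMap.ext fun Z => Subtype.ext (by
    simp [smul_sub])

/-- The modular shift `ρ ∈ 𝔞*`, `2ρ(X) = tr(ad X | 𝔫)`. -/
def rho {d : ℕ} (u : Fin d → ℝ) : lieA u →ₗ[ℝ] ℝ :=
  (1 / 2 : ℝ) • (LinearMap.trace ℝ (lieN u) ∘ₗ adN u)

/-- The defining property of `ρ`: `a^(2ρ) = det(Ad a | 𝔫)` for `a = exp X`. -/
lemma rho_spec {d : ℕ} (u : Fin d → ℝ) (X : lieA u) (E : Module.End ℝ (lieN u))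
    (hE : ∀ Y : lieN u, (E Y : Mat d) = NormedSpace.exp (X : Mat d) * Y *
      NormedSpace.exp (-(X : Mat d))) :
    Real.exp (2 * rho u X) = LinearMap.det E := by
  obtain ⟨c, hc⟩ := Submodule.mem_span_singleton.mp X.2
  have h1 : adN u X = c • LinearMap.id := by
    ext1 Y
    apply Subtype.ext
    show (X : Mat d) * Y - Y * X = c • (Y : Mat d)
    rw [← hc, Matrix.smul_mul, Matrix.mul_smul, ← smul_sub, Y.2.2]
  have h2 : E = Real.exp c • LinearMap.id := by
    ext1 Y
    apply Subtype.ext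
    rw [hE]
    show _ = Real.exp c • (Y : Mat d)
    have hXY : (Y : Mat d) * ((X : Mat d) + c • 1) = (X : Mat d) * Y := by
      have h3 : H u * (Y : Mat d) = Y * H u + Y := by
        nth_rewrite 3 [← Y.2.2]
        abel
      rw [← hc, Matrix.mul_add, Matrix.smul_mul, h3, smul_add, Matrix.mul_smul, Matrix.mul_smul,
        Matrix.mul_one]
    have hs : SemiconjBy (Y : Mat d) ((X : Mat d) + c • 1) (X : Mat d) := hXY
    have h4 : NormedSpace.exp (X : Mat d) * Y
        = Y * NormedSpace.exp ((X : Mat d) + c • (1 : Mat d)) := exp_semiconj hs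
    have h5 : NormedSpace.exp (c • (1 : Mat d)) = Real.exp c • (1 : Mat d) := by
      rw [Matrix.smul_one_eq_diagonal, Matrix.smul_one_eq_diagonal, Matrix.exp_diagonal,
        Pi.exp_def, Real.exp_eq_exp_ℝ]
    rw [h4, Matrix.mul_assoc, Matrix.exp_add_of_commute _ _ ((Commute.one_right _).smul_right c), h5]
    simp only [Matrix.mul_smul, Matrix.smul_mul, Matrix.mul_one]
    rw [← Matrix.exp_add_of_commute _ _ (by simp)]
    simp
  rw [h2, LinearMap.det_smul, LinearMap.det_id, mul_one, ← Real.exp_nat_mul]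
  simp only [rho, LinearMap.smul_apply, LinearMap.comp_apply, h1, map_smul,
    LinearMap.trace_id, smul_eq_mul]
  ring_nf

/-- The order on real functionals on `𝔞` for which `tρ > 0 ↔ t > 0`. -/
def PosOnA {d : ℕ} (u : Fin d → ℝ) (μ : lieA u →ₗ[ℝ] ℝ) : Prop := ∃ t : ℝ, 0 < t ∧ μ = t • rho u

/-- Smoothness of a vector valued function on the closed submanifold `G` of the space of matrices:
locally it is the restriction of a smooth function of the matrix. -/
def SmoothOnG {d : ℕ} {V : Type*} [NormedAddCommGroup V] [NormedSpace ℝ V] (f : G d → V) : Prop :=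
  ∀ g : G d, ∃ U : Set (Mat d), IsOpen U ∧ (g : Mat d) ∈ U ∧
    ∃ F : Mat d → V, ContDiffOn ℝ ∞ F U ∧ ∀ h : G d, (h : Mat d) ∈ U → F h = f h

section Series

variable {d : ℕ} {u : Fin d → ℝ} {V : Type*} [NormedAddCommGroup V] [NormedSpace ℂ V]

/-- The space of smooth vectors of the principal series representation: smooth `f : G → V_σ` with
`f(m a n x) = a^(λ+ρ) σ(m) f(x)`, where `a = exp X`, `a^(λ+ρ) = e^((λ+ρ)(X))`. The group `G` acts
by right translation. -/
def smoothSeries (σ : Representation ℂ (M u) V) (lam : lieA u →ₗ[ℝ] ℂ) :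
    Submodule ℂ (G d → V) where
  carrier := {f | SmoothOnG f ∧ ∀ (m : M u) (X : lieA u), ∀ n ∈ N u, ∀ x : G d,
    f (m * expA X * n * x) = Complex.exp (lam X + (rho u X : ℂ)) • σ m (f x)}
  add_mem' := by
    rintro f f' ⟨sf, hf⟩ ⟨sf', hf'⟩
    refine ⟨fun g => ?_, fun m X n hn x => ?_⟩
    · obtain ⟨U, oU, gU, F, cF, eF⟩ := sf g
      obtain ⟨U', oU', gU', F', cF', eF'⟩ := sf' g
      exact ⟨U ∩ U', oU.inter oU', ⟨gU, gU'⟩, fun x => F x + F' x,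
        (cF.mono Set.inter_subset_left).add (cF'.mono Set.inter_subset_right),
        fun h hh => by simp [eF h hh.1, eF' h hh.2]⟩
    · simp [hf m X n hn x, hf' m X n hn x]
  zero_mem' := ⟨fun g => ⟨Set.univ, isOpen_univ, trivial, fun _ => 0, contDiffOn_const,
    fun _ _ => rfl⟩, by simp⟩
  smul_mem' := by
    rintro c f ⟨sf, hf⟩
    refine ⟨fun g => ?_, fun m X n hn x => ?_⟩
    · obtain ⟨U, oU, gU, F, cF, eF⟩ := sf g
      exact ⟨U, oU, gU, fun x => c • F x, cF.const_smul c, fun h hh => by simp [eF h hh]⟩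
    · simp [hf m X n hn x, smul_comm c]

/-- The space of `M`-invariant smooth vectors. -/
def smoothSeriesM (σ : Representation ℂ (M u) V) (lam : lieA u →ₗ[ℝ] ℂ) :
    Submodule ℂ (G d → V) where
  carrier := {f | f ∈ smoothSeries σ lam ∧ ∀ (m : M u) (x : G d), f (x * m) = f x}
  add_mem' := by
    rintro f f' ⟨sf, hf⟩ ⟨sf', hf'⟩
    exact ⟨add_mem sf sf', fun m x => by simp [hf m x, hf' m x]⟩
  zero_mem' := ⟨zero_mem _, by simp⟩
  smul_mem' := by
    rintro c f ⟨sf, hf⟩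
    exact ⟨Submodule.smul_mem _ c sf, fun m x => by simp [hf m x]⟩

/-- The integrand `l(f(w₀ n₀ a)) a^(-k λ_γ)` at `a = exp(t H₁)`. -/
def integrand (lamγ : lieA u →ₗ[ℝ] ℂ) (w₀ n₀ : G d) (k : ℤ) (l : Module.Dual ℂ V) (f : G d → V)
    (t : ℝ) : ℂ :=
  l (f (w₀ * n₀ * expA (t • H₁ u))) * Complex.exp (-(k : ℂ) * lamγ (t • H₁ u))

/-- The integral of `l(f(w₀ n₀ a)) a^(-k λ_γ)` over `A`, with the Haar measure given by arc
length. -/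
def I (lamγ : lieA u →ₗ[ℝ] ℂ) (w₀ n₀ : G d) (k : ℤ) (l : Module.Dual ℂ V) (f : G d → V) : ℂ :=
  ∫ t : ℝ, integrand lamγ w₀ n₀ k l f t

end Series

/-- `w` is a representative in `K` of the non-trivial element of the Weyl group
`W(G, A) = N_K(A) / Z_K(A)`. -/
def IsWeylRep {d : ℕ} (u : Fin d → ℝ) (w : G d) : Prop :=
  w ∈ K d ∧ (∀ a : G d, a ∈ A u ↔ w * a * w⁻¹ ∈ A u) ∧ w ∉ M u

/-- `|c_k| = O(|k|^(-N))` as `|k| → ∞`, for every `N`. -/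
def RapidlyDecreasing (c : ℤ → ℂ) : Prop :=
  ∀ N : ℕ, c =O[Filter.cofinite] fun k : ℤ => (|(k : ℝ)| ^ N)⁻¹

end HypFourier

end

/-! With the null vectors `ξ = (u, 1)` and `η = (-u, 1)` one has `exp(tH₁) ξ = e^t ξ`,
`exp(tH₁) η = e^(-t) η`; the group `N` fixes `ξ` and moves `η` simply transitively through the null
directions different from `ξ`, and `w₀` swaps `ξ` and `η`. So `g` lies in the big Bruhat cell
`A N M w₀ N` as soon as `g ξ ∉ ℝ ξ`. For such `g = a n₁ m w₀ n(Y)` the relation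
`n(Y) exp(tH₁) = exp(tH₁) n(e^(-t) Y)` gives `f(g exp(tH₁)) = e^(-zt) φ(e^(-t))` with
`z = (λ + ρ)(H₁)` and `φ` smooth at `0`. This applies to `g = w₀ n₀` as `t → ∞`. As `t → -∞` it
applies to `g = w₀ n₀ w₀⁻¹`, because `exp(tH₁) = w₀⁻¹ exp(-tH₁) w₀` and `n₀ ≠ 1`. As `Re z > 0`,
the function `t ↦ l(f(w₀ n₀ exp(tH₁)))` and all its derivatives decay exponentially at both ends,
and `k ↦ I_k` samples its Fourier transform along a lattice. -/

noncomputable section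

namespace HypFourier

open MeasureTheory Filter Topology FourierTransform

section ExpTails

variable {E : Type*} [NormedAddCommGroup E] [NormedSpace ℂ E]

lemma integrable_fourierChar_smul {g : ℝ → E} (hg : Integrable g) (x : ℝ) :
    Integrable fun t => 𝐞 (-(t * x)) • g t := by
  simpa [mul_comm] using (Real.fourierIntegral_convergent_iff x).mpr hg

lemma abs_pow_mul_norm_fourier_le {g : ℝ → E} {n : ℕ} (hg : ContDiff ℝ n g)
    (hi : ∀ j ≤ n, Integrable (iteratedDeriv j g)) (x : ℝ) :
    |2 * Real.pi * x| ^ n * ‖𝓕 g x‖ ≤ ∫ t, ‖iteratedDeriv n g t‖ := by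
  have hderiv : 𝓕 (iteratedDeriv n g) x = (2 * Real.pi * Complex.I * x) ^ n • 𝓕 g x :=
    congrFun (Real.fourier_iteratedDeriv (N := n) hg (fun j hj => hi j (by exact_mod_cast hj))
      le_rfl) x
  calc |2 * Real.pi * x| ^ n * ‖𝓕 g x‖ = ‖𝓕 (iteratedDeriv n g) x‖ := by
        rw [hderiv, norm_smul, norm_pow]
        simp [abs_mul]
    _ ≤ ∫ t, ‖iteratedDeriv n g t‖ :=
        VectorFourier.norm_fourierIntegral_le_integral_norm _ _ _ _ _

lemma rapidlyDecreasing_fourier {g : ℝ → ℂ} (hg : ContDiff ℝ ∞ g)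
    (hi : ∀ n, Integrable (iteratedDeriv n g)) {c : ℝ} (hc : c ≠ 0) :
    RapidlyDecreasing fun k : ℤ => 𝓕 g (k * c) := by
  intro n
  refine .of_bound ((∫ t, ‖iteratedDeriv n g t‖) / |2 * Real.pi * c| ^ n) ?_
  filter_upwards [(Set.finite_singleton (0 : ℤ)).compl_mem_cofinite] with k hk
  have hk' : 0 < |(k : ℝ)| := abs_pos.mpr (by exact_mod_cast hk)
  have hbound := abs_pow_mul_norm_fourier_le (hg.of_le (by exact_mod_cast le_top))
    (fun j _ => hi j) (n := n) (k * c)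
  rw [norm_inv, norm_pow, Real.norm_eq_abs, abs_abs, ← div_eq_mul_inv, div_div,
    le_div_iff₀ (by positivity), ← mul_pow, ← abs_mul, mul_comm]
  rwa [show 2 * Real.pi * (k * c) = 2 * Real.pi * c * k by ring] at hbound

/-- Functions of the form `e^(zt) φ(e^(ct))` with `φ` smooth on all of `ℝ`. The point is the
smoothness of `φ` at `0`, which controls the function and all its derivatives at the end of the
line where `ct → -∞`. -/
def IsExpSmooth (z : ℂ) (c : ℝ) (g : ℝ → E) : Prop :=
  ∃ φ : ℝ → E, ContDiff ℝ ∞ φ ∧ g = fun t : ℝ => Complex.exp (z * t) • φ (Real.exp (c * t))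

namespace IsExpSmooth

variable {z : ℂ} {c : ℝ} {g : ℝ → E}

lemma contDiff (hg : IsExpSmooth z c g) : ContDiff ℝ ∞ g := by
  obtain ⟨φ, hφ, rfl⟩ := hg
  have hexp : ContDiff ℝ ∞ fun t : ℝ => Complex.exp (z * t) :=
    (contDiff_const.mul Complex.ofRealCLM.contDiff).cexp
  exact hexp.smul (hφ.comp (contDiff_const.mul contDiff_id).exp)

lemma comp_neg (hg : IsExpSmooth z c g) : IsExpSmooth (-z) (-c) fun t => g (-t) := by
  obtain ⟨φ, hφ, rfl⟩ := hg
  exact ⟨φ, hφ, by simp⟩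

lemma deriv (hg : IsExpSmooth z c g) : IsExpSmooth z c (deriv g) := by
  obtain ⟨φ, hφ, rfl⟩ := hg
  refine ⟨fun s => z • φ s + (c * s) • _root_.deriv φ s,
    (contDiff_const.smul hφ).add
      ((contDiff_const.mul contDiff_id).smul (contDiff_infty_iff_deriv.mp hφ).2), ?_⟩
  funext t
  have hexp : HasDerivAt (fun t : ℝ => Complex.exp (z * t)) (Complex.exp (z * t) * (z * 1)) t :=
    ((Complex.ofRealCLM.hasDerivAt (x := t)).const_mul z).cexp
  have hφ' : HasDerivAt (fun t : ℝ => φ (Real.exp (c * t)))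
      ((Real.exp (c * t) * (c * 1)) • _root_.deriv φ (Real.exp (c * t))) t :=
    ((hφ.differentiable (by simp) _).hasDerivAt).scomp t ((hasDerivAt_id t).const_mul c).exp
  refine (hexp.smul hφ').deriv.trans ?_
  rw [smul_add, smul_smul, mul_one, mul_one, mul_comm (Real.exp _), add_comm]

lemma clm_comp {F : Type*} [NormedAddCommGroup F] [NormedSpace ℂ F] (hg : IsExpSmooth z c g)
    (L : E →L[ℂ] F) : IsExpSmooth z c (L ∘ g) := by
  obtain ⟨φ, hφ, rfl⟩ := hg
  exact ⟨L ∘ φ, (L.restrictScalars ℝ).contDiff.comp hφ, funext fun t => map_smul L _ _⟩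

lemma isBigO (hg : IsExpSmooth z c g) {F : Filter ℝ}
    (hF : Tendsto (fun t => Real.exp (c * t)) F (𝓝 0)) :
    g =O[F] fun t => Real.exp (z.re * t) := by
  obtain ⟨φ, hφ, rfl⟩ := hg
  have hφ' : (fun t => φ (Real.exp (c * t))) =O[F] fun _ => (1 : ℝ) :=
    (hφ.continuous.continuousAt.tendsto.comp hF).isBigO_one ℝ
  have hexp : (fun t : ℝ => Complex.exp (z * t)) =O[F] fun t => Real.exp (z.re * t) :=
    .of_norm_le fun t => by simp [Complex.norm_exp]
  simpa using hexp.smul hφ'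

end IsExpSmooth

/-- Functions on the line of the form `e^(-zt) φ(e^(-t))` and `e^(zt) ψ(e^t)` with `φ`, `ψ`
smooth on all of `ℝ`: smooth functions with exponential decay, together with all derivatives,
at both ends when `0 < re z`. -/
def HasExpTails (z : ℂ) (g : ℝ → E) : Prop :=
  IsExpSmooth (-z) (-1) g ∧ IsExpSmooth z 1 g

namespace HasExpTails

variable {z : ℂ} {g : ℝ → E}

lemma contDiff (hg : HasExpTails z g) : ContDiff ℝ ∞ g := hg.2.contDiff

lemma clm_comp {F : Type*} [NormedAddCommGroup F] [NormedSpace ℂ F] (hg : HasExpTails z g)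
    (L : E →L[ℂ] F) : HasExpTails z (L ∘ g) := ⟨hg.1.clm_comp L, hg.2.clm_comp L⟩

lemma iteratedDeriv (hg : HasExpTails z g) (n : ℕ) : HasExpTails z (iteratedDeriv n g) := by
  induction n with
  | zero => simpa only [iteratedDeriv_zero] using hg
  | succ n ih => simpa only [iteratedDeriv_succ] using ⟨ih.1.deriv, ih.2.deriv⟩

lemma integrable (hg : HasExpTails z g) (hz : 0 < z.re) : Integrable g := by
  have hbot : g =O[atBot] fun t => Real.exp (z.re * t) :=
    hg.2.isBigO (by simpa only [one_mul] using Real.tendsto_exp_atBot)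
  have htop : g =O[atTop] fun t => Real.exp ((-z).re * t) :=
    hg.1.isBigO (by simpa only [neg_one_mul] using Real.tendsto_exp_neg_atTop_nhds_zero)
  exact hg.contDiff.continuous.locallyIntegrable.integrable_of_isBigO_atBot_atTop
    hbot ⟨Set.Iic 0, Iic_mem_atBot 0, integrableOn_exp_mul_Iic hz 0⟩
    htop ⟨Set.Ioi 0, Ioi_mem_atTop 0, integrableOn_exp_mul_Ioi (by simpa using hz) 0⟩

lemma rapidlyDecreasing_fourier {g : ℝ → ℂ} (hg : HasExpTails z g) (hz : 0 < z.re) {c : ℝ}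
    (hc : c ≠ 0) : RapidlyDecreasing fun k : ℤ => 𝓕 g (k * c) :=
  HypFourier.rapidlyDecreasing_fourier hg.contDiff (fun n => (hg.iteratedDeriv n).integrable hz) hc

end HasExpTails

end ExpTails

attribute [local instance] Matrix.normedAddCommGroup Matrix.normedSpace

section MatrixExp

variable {n : Type*} [Fintype n] [DecidableEq n]

lemma exp_smul_eq_of_smul_eq {B : Matrix n n ℝ} {v : n → ℝ} {c : ℝ} (h : B • v = c • v) :
    NormedSpace.exp B • v = Real.exp c • v := by
  have hsemi : SemiconjBy (Matrix.replicateCol n v) (Matrix.diagonal fun _ => c) B := by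
    rw [SemiconjBy, ← Matrix.replicateCol_mulVec, ← Matrix.smul_eq_mulVec, h,
      ← Matrix.smul_one_eq_diagonal, Matrix.mul_smul, Matrix.mul_one, Matrix.replicateCol_smul]
  have hexp := exp_semiconj hsemi
  rw [Matrix.exp_diagonal, Pi.exp_def, ← Real.exp_eq_exp_ℝ, ← Matrix.smul_one_eq_diagonal,
    Matrix.mul_smul, Matrix.mul_one, ← Matrix.replicateCol_mulVec,
    ← Matrix.replicateCol_smul] at hexp
  funext i
  exact congrFun (congrFun hexp i) i

lemma exp_eq_of_pow_three_eq_zero {Y : Matrix n n ℝ} (h : Y ^ 3 = 0) :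
    NormedSpace.exp Y = 1 + Y + (1 / 2 : ℝ) • Y ^ 2 := by
  have hzero : ∀ k ∉ Finset.range 3, ((Nat.factorial k : ℝ)⁻¹) • Y ^ k = 0 := fun k hk => by
    rw [pow_eq_zero_of_le (by simpa using hk) h, smul_zero]
  rw [NormedSpace.exp_eq_tsum ℝ]
  change (∑' k : ℕ, ((Nat.factorial k : ℝ)⁻¹) • Y ^ k) = _
  rw [tsum_eq_sum hzero]
  simp [Finset.sum_range_succ, Nat.factorial]

end MatrixExp

variable {d : ℕ}

/-- The Lorentz form `x₁y₁ + ⋯ + x_d y_d - x_{d+1} y_{d+1}` on `ℝ^{d,1}`. -/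
def lorentzForm (d : ℕ) : LinearMap.BilinForm ℝ (Fin d ⊕ Unit → ℝ) := Matrix.toBilin' (J d)

local notation "⟪" v "," w "⟫" => lorentzForm _ v w

lemma lorentzForm_eq_dotProduct (v w : Fin d ⊕ Unit → ℝ) : ⟪v,w⟫ = v ⬝ᵥ J d *ᵥ w :=
  Matrix.toBilin'_apply' _ _ _

lemma lorentzForm_eq_sum (v w : Fin d ⊕ Unit → ℝ) :
    ⟪v,w⟫ = ∑ i, v (Sum.inl i) * w (Sum.inl i) - v (Sum.inr ()) * w (Sum.inr ()) := by
  simp [lorentzForm_eq_dotProduct, J, LieAlgebra.Orthogonal.indefiniteDiagonal,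
    Matrix.mulVec_diagonal, dotProduct, sub_eq_add_neg]

lemma lorentzForm_comm (v w : Fin d ⊕ Unit → ℝ) : ⟪v,w⟫ = ⟪w,v⟫ := by
  simp only [lorentzForm_eq_sum, mul_comm]

lemma lorentzForm_smul_smul (g : G d) (v w : Fin d ⊕ Unit → ℝ) : ⟪g • v,g • w⟫ = ⟪v,w⟫ := by
  change ⟪(g : Mat d) *ᵥ v,(g : Mat d) *ᵥ w⟫ = ⟪v,w⟫
  rw [lorentzForm_eq_dotProduct, ← Matrix.vecMul_transpose, ← Matrix.dotProduct_mulVec,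
    Matrix.mulVec_mulVec, Matrix.mulVec_mulVec, g.2.1, ← lorentzForm_eq_dotProduct]

lemma lorentzForm_inv_smul (g : G d) (v w : Fin d ⊕ Unit → ℝ) : ⟪g⁻¹ • v,w⟫ = ⟪v,g • w⟫ := by
  rw [← lorentzForm_smul_smul g, smul_inv_smul]

lemma mem_lieG_iff_lorentzForm {X : Mat d} :
    X ∈ lieG d ↔ ∀ v w : Fin d ⊕ Unit → ℝ, ⟪X • v,w⟫ = -⟪v,X • w⟫ := by
  rw [lieG, mem_skewAdjointMatricesSubmodule, Matrix.IsSkewAdjoint, ← isAdjointPair_toLinearMap₂']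
  refine forall₂_congr fun v w => ?_
  rw [← map_neg]
  simp only [Matrix.toLin'_apply, Matrix.neg_mulVec]
  rfl

/-- The endomorphism `v ↦ ⟪a,v⟫ b - ⟪b,v⟫ a` attached to the bivector `a ∧ b`. These span
`𝔰𝔬(d,1)`. -/
def bivec (a b : Fin d ⊕ Unit → ℝ) : Mat d :=
  Matrix.vecMulVec b (J d *ᵥ a) - Matrix.vecMulVec a (J d *ᵥ b)

lemma bivec_smul (a b v : Fin d ⊕ Unit → ℝ) : bivec a b • v = ⟪a,v⟫ • b - ⟪b,v⟫ • a := by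
  rw [bivec, sub_smul, Matrix.smul_eq_mulVec, Matrix.smul_eq_mulVec, Matrix.vecMulVec_mulVec,
    Matrix.vecMulVec_mulVec, dotProduct_comm, ← lorentzForm_eq_dotProduct, dotProduct_comm,
    ← lorentzForm_eq_dotProduct, lorentzForm_comm v, lorentzForm_comm v,
    op_smul_eq_smul, op_smul_eq_smul]

lemma mat_ext {X Y : Mat d} (h : ∀ v : Fin d ⊕ Unit → ℝ, X • v = Y • v) : X = Y :=
  Matrix.mulVec_injective (funext h)

lemma bivec_mem_lieG (a b : Fin d ⊕ Unit → ℝ) : bivec a b ∈ lieG d :=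
  mem_lieG_iff_lorentzForm.mpr fun v w => by
    simp only [bivec_smul, map_sub, map_smul, LinearMap.sub_apply, LinearMap.smul_apply,
      smul_eq_mul, lorentzForm_comm v]
    ring

lemma mul_bivec (g : G d) (a b : Fin d ⊕ Unit → ℝ) :
    (g : Mat d) * bivec a b = bivec (g • a) (g • b) * g := mat_ext fun v => by
  have h (x : Fin d ⊕ Unit → ℝ) : ⟪g • x,(g : Mat d) • v⟫ = ⟪x,v⟫ := lorentzForm_smul_smul g x v
  simp only [mul_smul, bivec_smul, h, smul_sub, smul_comm (g : Mat d)]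
  rfl

lemma lie_bivec {X : Mat d} (hX : X ∈ lieG d) (a b : Fin d ⊕ Unit → ℝ) :
    X * bivec a b - bivec a b * X = bivec (X • a) b + bivec a (X • b) := mat_ext fun v => by
  simp only [sub_smul, add_smul, mul_smul, bivec_smul, mem_lieG_iff_lorentzForm.mp hX, smul_sub,
    smul_comm X, neg_smul]
  abel

lemma bivec_smul_smul_left (c : ℝ) (a b : Fin d ⊕ Unit → ℝ) : bivec (c • a) b = c • bivec a b :=
  mat_ext fun v => by
    simp only [smul_assoc, bivec_smul, map_smul, LinearMap.smul_apply, smul_sub, smul_smul,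
      smul_eq_mul, mul_comm c]

lemma bivec_smul_smul_right (c : ℝ) (a b : Fin d ⊕ Unit → ℝ) : bivec a (c • b) = c • bivec a b :=
  mat_ext fun v => by
    simp only [smul_assoc, bivec_smul, map_smul, LinearMap.smul_apply, smul_sub, smul_smul,
      smul_eq_mul, mul_comm c]

lemma bivec_comm (a b : Fin d ⊕ Unit → ℝ) : bivec b a = -bivec a b := (neg_sub _ _).symm

/-- The null vector `(u, 1)`, spanning the attracting fixed line of the translations
`exp (t H₁)`. -/
def attractingNull (u : Fin d → ℝ) : Fin d ⊕ Unit → ℝ := Sum.elim u 1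

/-- The null vector `(-u, 1)`, spanning the repelling fixed line of the translations
`exp (t H₁)`. -/
def repellingNull (u : Fin d → ℝ) : Fin d ⊕ Unit → ℝ := Sum.elim (-u) 1

variable {u : Fin d → ℝ}

local notation "ξ" => attractingNull u
local notation "η" => repellingNull u
local notation "a[" t "]" => expA (t • H₁ u)

lemma attractingNull_add_repellingNull :
    ξ + η = (2 : ℝ) • (Pi.single (Sum.inr ()) 1 : Fin d ⊕ Unit → ℝ) := by
  ext (i | i) <;> simp [attractingNull, repellingNull, one_add_one_eq_two]

lemma lorentzForm_attractingNull_self (hu : ∑ i, u i ^ 2 = 1) : ⟪ξ,ξ⟫ = 0 := by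
  simp [lorentzForm_eq_sum, attractingNull, ← pow_two, hu]

lemma lorentzForm_repellingNull_self (hu : ∑ i, u i ^ 2 = 1) : ⟪η,η⟫ = 0 := by
  simp [lorentzForm_eq_sum, repellingNull, ← pow_two, hu]

lemma lorentzForm_attractingNull_repellingNull (hu : ∑ i, u i ^ 2 = 1) : ⟪ξ,η⟫ = -2 := by
  norm_num [lorentzForm_eq_sum, attractingNull, repellingNull, ← pow_two, hu]

lemma lorentzForm_self_pos {a : Fin d ⊕ Unit → ℝ} (ha : a ≠ 0) (hξ : ⟪a,ξ⟫ = 0)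
    (hη : ⟪a,η⟫ = 0) : 0 < ⟪a,a⟫ := by
  have hsum : ⟪a,ξ + η⟫ = 0 := by rw [map_add, hξ, hη, add_zero]
  have htime : a (Sum.inr ()) = 0 := by
    rw [attractingNull_add_repellingNull, map_smul] at hsum
    simpa [lorentzForm_eq_sum] using hsum
  have hspace : ∃ i, a (Sum.inl i) ≠ 0 := by
    by_contra! h
    exact ha (funext (Sum.rec h fun _ => htime))
  obtain ⟨i, hi⟩ := hspace
  rw [lorentzForm_eq_sum, htime, mul_zero, sub_zero]
  exact Finset.sum_pos' (fun j _ => mul_self_nonneg _) ⟨i, Finset.mem_univ i, mul_self_pos.mpr hi⟩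

lemma H_eq_bivec : H u = (1 / 2 : ℝ) • bivec ξ η := by
  ext (i | i) (j | j) <;>
    simp [H, bivec, attractingNull, repellingNull, Matrix.vecMulVec_apply, J,
      LieAlgebra.Orthogonal.indefiniteDiagonal, Matrix.mulVec_diagonal] <;> ring

lemma H_smul (v : Fin d ⊕ Unit → ℝ) : H u • v = (1 / 2 : ℝ) • (⟪ξ,v⟫ • η - ⟪η,v⟫ • ξ) := by
  rw [H_eq_bivec, smul_assoc, bivec_smul]

lemma H_smul_attractingNull (hu : ∑ i, u i ^ 2 = 1) : H u • ξ = ξ := by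
  rw [H_smul, lorentzForm_attractingNull_self hu, lorentzForm_comm η,
    lorentzForm_attractingNull_repellingNull hu]
  module

lemma H_smul_repellingNull (hu : ∑ i, u i ^ 2 = 1) : H u • η = -η := by
  rw [H_smul, lorentzForm_repellingNull_self hu, lorentzForm_attractingNull_repellingNull hu]
  module

lemma H_smul_eq_zero {a : Fin d ⊕ Unit → ℝ} (hξ : ⟪a,ξ⟫ = 0) (hη : ⟪a,η⟫ = 0) : H u • a = 0 := by
  rw [H_smul, lorentzForm_comm, hξ, lorentzForm_comm, hη]
  module

lemma G_ext {g h : G d} (hgh : (g : Mat d) = h) : g = h := Subtype.ext (Units.ext hgh)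

lemma expA_smul_eq_of_smul_eq {v : Fin d ⊕ Unit → ℝ} {c : ℝ} (h : H u • v = c • v) (t : ℝ) :
    a[t] • v = Real.exp (t * c) • v :=
  exp_smul_eq_of_smul_eq (B := t • H u) (by rw [smul_assoc, h, smul_smul])

lemma expA_smul_attractingNull (hu : ∑ i, u i ^ 2 = 1) (t : ℝ) : a[t] • ξ = Real.exp t • ξ := by
  simpa using expA_smul_eq_of_smul_eq (c := 1) (by rw [H_smul_attractingNull hu, one_smul]) t

lemma expA_smul_repellingNull (hu : ∑ i, u i ^ 2 = 1) (t : ℝ) : a[t] • η = Real.exp (-t) • η := by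
  simpa using expA_smul_eq_of_smul_eq (c := -1) (by rw [H_smul_repellingNull hu, neg_one_smul]) t

lemma expA_smul_eq_self {a : Fin d ⊕ Unit → ℝ} (hξ : ⟪a,ξ⟫ = 0) (hη : ⟪a,η⟫ = 0) (t : ℝ) :
    a[t] • a = a := by
  simpa using expA_smul_eq_of_smul_eq (c := 0) (by rw [H_smul_eq_zero hξ hη, zero_smul]) t

lemma exists_eq_smul_H₁ (X : lieA u) : ∃ t : ℝ, X = t • H₁ u := by
  obtain ⟨t, ht⟩ := Submodule.mem_span_singleton.mp X.2
  exact ⟨t, Subtype.ext ht.symm⟩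

lemma smul_attractingNull_add_repellingNull {g : G d} (hg : g ∈ K d) : g • (ξ + η) = ξ + η := by
  rw [attractingNull_add_repellingNull, smul_comm]
  exact congrArg _ hg

lemma mem_K_of_smul_add {g : G d} (hg : g • (ξ + η) = ξ + η) : g ∈ K d := by
  rw [attractingNull_add_repellingNull, smul_comm] at hg
  exact smul_right_injective _ two_ne_zero hg

lemma mem_M_of_smul_null {g : G d} (hξ : g • ξ = ξ) (hη : g • η = η) : g ∈ M u := by
  have hH : (g : Mat d) * H u = H u * g := by
    rw [H_eq_bivec, Matrix.mul_smul, Matrix.smul_mul, mul_bivec, hξ, hη]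
  refine ⟨Subgroup.mem_centralizer_iff.mpr ?_, mem_K_of_smul_add (by rw [smul_add, hξ, hη])⟩
  rintro _ ⟨X, rfl⟩
  obtain ⟨t, rfl⟩ := exists_eq_smul_H₁ X
  refine G_ext (exp_semiconj (P := t • H u) (Q := t • H u) ?_)
  rw [SemiconjBy, Matrix.mul_smul, hH, Matrix.smul_mul]

lemma mul_expA_of_swap_null {g : G d} (hξ : g • ξ = η) (hη : g • η = ξ) (t : ℝ) :
    g * a[t] = a[-t] * g := by
  have hH : (g : Mat d) * H u = -H u * g := by
    rw [H_eq_bivec, Matrix.mul_smul, mul_bivec, hξ, hη, bivec_comm, Matrix.neg_mul,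
      Matrix.neg_mul, Matrix.smul_mul, smul_neg]
  refine (G_ext (exp_semiconj (P := t • H u) (Q := -t • H u) ?_)).symm
  rw [SemiconjBy, Matrix.mul_smul, hH, neg_smul, Matrix.neg_mul, Matrix.neg_mul,
    Matrix.smul_mul, smul_neg]

lemma exists_exp_smul_add_of_isWeylRep (hu : ∑ i, u i ^ 2 = 1) {w : G d} (hw : IsWeylRep u w) :
    ∃ s : ℝ, Real.exp s • ξ + Real.exp (-s) • η =
      Real.exp 1 • w • ξ + Real.exp (-1) • w • η := by
  obtain ⟨X, hX⟩ := (hw.2.1 a[(1 : ℝ)]).mp ⟨_, rfl⟩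
  obtain ⟨s, rfl⟩ := exists_eq_smul_H₁ X
  have h : a[s] • (ξ + η) = w • a[(1 : ℝ)] • (ξ + η) := by
    rw [← mul_smul w, ← eq_mul_inv_iff_mul_eq.mp hX, mul_smul,
      smul_attractingNull_add_repellingNull hw.1]
  refine ⟨s, ?_⟩
  simpa only [smul_add, expA_smul_attractingNull hu, expA_smul_repellingNull hu, smul_comm w]
    using h

lemma IsWeylRep.smul_null (hu : ∑ i, u i ^ 2 = 1) {w : G d} (hw : IsWeylRep u w) :
    w • ξ = η ∧ w • η = ξ := by
  have hbase : w • (ξ + η) = ξ + η := smul_attractingNull_add_repellingNull hw.1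
  have hwη : w • η = ξ + η - w • ξ := by rw [← hbase, smul_add, add_sub_cancel_left]
  obtain ⟨s, hs⟩ := exists_exp_smul_add_of_isWeylRep hu hw
  have hξ : ⟪ξ,ξ + η⟫ = -2 := by
    rw [map_add, lorentzForm_attractingNull_self hu, lorentzForm_attractingNull_repellingNull hu,
      zero_add]
  have hη : ⟪η,ξ + η⟫ = -2 := by
    rw [map_add, lorentzForm_repellingNull_self hu, lorentzForm_comm,
      lorentzForm_attractingNull_repellingNull hu, add_zero]
  have hw' (v : Fin d ⊕ Unit → ℝ) : ⟪w • v,ξ + η⟫ = ⟪v,ξ + η⟫ := by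
    rw [← lorentzForm_smul_smul w v, hbase]
  have hcosh : Real.cosh s = Real.cosh 1 := by
    have h := congrArg (⟪·,ξ + η⟫) hs
    simp only [map_add _ (Real.exp _ • _), map_smul, LinearMap.add_apply, LinearMap.smul_apply,
      hw', hξ, hη, smul_eq_mul] at h
    rw [Real.cosh_eq, Real.cosh_eq]
    linarith
  have hs1 : |s| = |1| :=
    le_antisymm (Real.cosh_le_cosh.mp hcosh.le) (Real.cosh_le_cosh.mp hcosh.ge)
  have hne : Real.exp 1 - Real.exp (-1) ≠ 0 :=
    (sub_pos.mpr (Real.exp_lt_exp.mpr (by norm_num))).ne'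
  rcases abs_eq_abs.mp hs1 with rfl | rfl
  · have hfix : w • ξ = ξ := smul_right_injective _ hne <| by
      rw [hwη] at hs
      generalize w • ξ = v at hs ⊢
      linear_combination (norm := module) -hs
    exact absurd (mem_M_of_smul_null hfix (by rw [hwη, hfix, add_sub_cancel_left])) hw.2.2
  · have hswap : w • ξ = η := smul_right_injective _ hne <| by
      rw [hwη, neg_neg] at hs
      generalize w • ξ = v at hs ⊢
      linear_combination (norm := module) -hs
    exact ⟨hswap, by rw [hwη, hswap, add_sub_cancel_right]⟩

lemma lorentzForm_smul_self {Y : Mat d} (hY : Y ∈ lieG d) (v : Fin d ⊕ Unit → ℝ) :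
    ⟪Y • v,v⟫ = 0 :=
  self_eq_neg.mp ((mem_lieG_iff_lorentzForm.mp hY v v).trans (by rw [lorentzForm_comm]))

lemma H_smul_smul_of_mem_lieN {Y : Mat d} (hY : Y ∈ lieN u) (v : Fin d ⊕ Unit → ℝ) :
    H u • Y • v = Y • v + Y • H u • v := by
  rw [← mul_smul, ← mul_smul, ← add_smul, ← sub_eq_iff_eq_add.mp hY.2]

lemma bivec_attractingNull_mem_lieN (hu : ∑ i, u i ^ 2 = 1) {a : Fin d ⊕ Unit → ℝ}
    (hξ : ⟪a,ξ⟫ = 0) (hη : ⟪a,η⟫ = 0) : bivec a ξ ∈ lieN u := by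
  refine ⟨bivec_mem_lieG a ξ, ?_⟩
  rw [lie_bivec (H_mem u), H_smul_eq_zero hξ hη, H_smul_attractingNull hu,
    ← zero_smul ℝ (0 : Fin d ⊕ Unit → ℝ), bivec_smul_smul_left, zero_smul, zero_add]

lemma smul_attractingNull_of_mem_lieN (hu : ∑ i, u i ^ 2 = 1) {Y : Mat d} (hY : Y ∈ lieN u) :
    Y • ξ = 0 := by
  -- `Y • ξ` would be an eigenvector of `H u` with eigenvalue `2`, but it is orthogonal to `ξ`, `η`.
  have hH : H u • Y • ξ = (2 : ℝ) • Y • ξ := by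
    rw [H_smul_smul_of_mem_lieN hY, H_smul_attractingNull hu, two_smul]
  have hskew := mem_lieG_iff_lorentzForm.mp (H_mem u)
  have hη : ⟪Y • ξ,η⟫ = 0 := by
    have h := hskew (Y • ξ) η
    rw [hH, H_smul_repellingNull hu, map_neg, map_smul, LinearMap.smul_apply, smul_eq_mul] at h
    linarith
  rw [H_smul_eq_zero (lorentzForm_smul_self hY.1 ξ) hη] at hH
  exact (smul_eq_zero.mp hH.symm).resolve_left two_ne_zero

lemma exists_eq_bivec_of_mem_lieN (hu : ∑ i, u i ^ 2 = 1) {Y : Mat d} (hY : Y ∈ lieN u) :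
    ∃ a : Fin d ⊕ Unit → ℝ, ⟪a,ξ⟫ = 0 ∧ ⟪a,η⟫ = 0 ∧ Y = bivec a ξ := by
  have hskew := mem_lieG_iff_lorentzForm.mp hY.1
  have hYξ : Y • ξ = 0 := smul_attractingNull_of_mem_lieN hu hY
  have hself : ⟪Y • η,η⟫ = 0 := lorentzForm_smul_self hY.1 η
  have hleft (v : Fin d ⊕ Unit → ℝ) : ⟪ξ,Y • v⟫ = 0 := by
    rw [← neg_eq_zero, ← hskew, hYξ, map_zero, LinearMap.zero_apply]
  refine ⟨(1 / 2 : ℝ) • Y • η, ?_, ?_, mat_ext fun v => ?_⟩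
  · rw [map_smul, LinearMap.smul_apply, lorentzForm_comm, hleft, smul_zero]
  · rw [map_smul, LinearMap.smul_apply, hself, smul_zero]
  · have hv : H u • Y • v - Y • H u • v = Y • v := by
      rw [H_smul_smul_of_mem_lieN hY, add_sub_cancel_right]
    rw [bivec_smul, ← hv, H_smul, H_smul, hleft, smul_comm Y, smul_sub Y, smul_comm Y ⟪ξ,v⟫,
      smul_comm Y ⟪η,v⟫, hYξ, ← neg_neg ⟪η,Y • v⟫, ← hskew, map_smul _ (1 / 2 : ℝ),
      LinearMap.smul_apply, smul_eq_mul]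
    generalize Y • η = b
    module

/-- The exponential map from `𝔫` to `G`. -/
def expN (Y : lieN u) : G d := expG ⟨Y, Y.2.1⟩

lemma expN_mem (Y : lieN u) : expN Y ∈ N u := ⟨_, Y.2, rfl⟩

lemma exists_eq_expN {n : G d} (hn : n ∈ N u) : ∃ Y : lieN u, n = expN Y := by
  obtain ⟨Y, hY, rfl⟩ := hn
  exact ⟨⟨Y, hY⟩, rfl⟩

lemma expN_zero : expN (0 : lieN u) = 1 := G_ext NormedSpace.exp_zero

lemma expN_neg (Y : lieN u) : expN (-Y) = (expN Y)⁻¹ := G_ext rfl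

lemma expN_mul_expA (hu : ∑ i, u i ^ 2 = 1) (Y : lieN u) (t : ℝ) :
    expN Y * a[t] = a[t] * expN (Real.exp (-t) • Y) := by
  obtain ⟨a, hξ, hη, hY⟩ := exists_eq_bivec_of_mem_lieN hu Y.2
  refine G_ext (exp_semiconj (P := Real.exp (-t) • (Y : Mat d)) ?_)
  rw [SemiconjBy, hY, Matrix.mul_smul, mul_bivec, expA_smul_eq_self hξ hη,
    expA_smul_attractingNull hu, bivec_smul_smul_right, Matrix.smul_mul, smul_smul,
    ← Real.exp_add, neg_add_cancel, Real.exp_zero, one_smul]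

lemma bivec_attractingNull_pow_three (hu : ∑ i, u i ^ 2 = 1) {a : Fin d ⊕ Unit → ℝ}
    (hξ : ⟪a,ξ⟫ = 0) : bivec a ξ ^ 3 = 0 := mat_ext fun v => by
  simp only [pow_succ, pow_zero, one_mul, mul_smul, bivec_smul, map_sub, map_smul,
    lorentzForm_comm ξ a, hξ, lorentzForm_attractingNull_self hu, smul_eq_mul, mul_zero, sub_zero,
    zero_smul]

lemma coe_expN (hu : ∑ i, u i ^ 2 = 1) (Y : lieN u) :
    (expN Y : Mat d) = 1 + (Y : Mat d) + (1 / 2 : ℝ) • (Y : Mat d) ^ 2 := by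
  obtain ⟨a, hξ, -, hY⟩ := exists_eq_bivec_of_mem_lieN hu Y.2
  exact exp_eq_of_pow_three_eq_zero (by rw [hY, bivec_attractingNull_pow_three hu hξ])

lemma expN_smul (hu : ∑ i, u i ^ 2 = 1) (Y : lieN u) (v : Fin d ⊕ Unit → ℝ) :
    expN Y • v = v + (Y : Mat d) • v + (1 / 2 : ℝ) • (Y : Mat d) • (Y : Mat d) • v := by
  change (expN Y : Mat d) • v = _
  rw [coe_expN hu, add_smul, add_smul, one_smul, smul_assoc, pow_two, mul_smul]

lemma expN_smul_attractingNull (hu : ∑ i, u i ^ 2 = 1) (Y : lieN u) : expN Y • ξ = ξ := by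
  rw [expN_smul hu, smul_attractingNull_of_mem_lieN hu Y.2]
  simp only [smul_zero, add_zero]

lemma expN_smul_repellingNull (hu : ∑ i, u i ^ 2 = 1) {Y : lieN u} {a : Fin d ⊕ Unit → ℝ}
    (hξ : ⟪a,ξ⟫ = 0) (hη : ⟪a,η⟫ = 0) (hY : (Y : Mat d) = bivec a ξ) :
    expN Y • η = η + (2 : ℝ) • a + ⟪a,a⟫ • ξ := by
  rw [expN_smul hu, hY]
  simp only [bivec_smul, map_sub, map_smul, hη, lorentzForm_attractingNull_repellingNull hu,
    lorentzForm_comm ξ a, hξ, smul_eq_mul]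
  module

lemma exists_eq_smul_expN_smul_of_null (hu : ∑ i, u i ^ 2 = 1) {v : Fin d ⊕ Unit → ℝ}
    (hv : ⟪v,v⟫ = 0) (hvξ : ⟪v,ξ⟫ ≠ 0) : ∃ Y : lieN u, v = (-⟪v,ξ⟫ / 2) • expN Y • η := by
  have hξξ := lorentzForm_attractingNull_self hu
  have hηη := lorentzForm_repellingNull_self hu
  have hξη := lorentzForm_attractingNull_repellingNull hu
  have hηξ := (lorentzForm_comm η ξ).trans hξη
  obtain ⟨c, hc⟩ : ∃ c, ⟪v,ξ⟫ = -2 * c := ⟨-⟪v,ξ⟫ / 2, by ring⟩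
  obtain ⟨e, he⟩ : ∃ e, ⟪v,η⟫ = -2 * e := ⟨-⟪v,η⟫ / 2, by ring⟩
  have hc0 : c ≠ 0 := right_ne_zero_of_mul (hc ▸ hvξ)
  set a := (2 * c)⁻¹ • (v - c • η - e • ξ) with ha
  have haξ : ⟪a,ξ⟫ = 0 := by simp [ha, hc, hξξ, hηξ, mul_comm]
  have haη : ⟪a,η⟫ = 0 := by simp [ha, he, hξη, hηη, mul_comm]
  have hva : v = c • η + (2 * c) • a + e • ξ := by
    rw [ha, smul_inv_smul₀ (mul_ne_zero two_ne_zero hc0)]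
    module
  have haa : c * ⟪a,a⟫ = e := by
    rw [hva] at hv
    simp only [map_add, map_smul, LinearMap.add_apply, LinearMap.smul_apply, smul_eq_mul, hξξ, hηη,
      hξη, hηξ, haξ, haη, lorentzForm_comm ξ a, lorentzForm_comm η a] at hv
    exact mul_left_cancel₀ hc0 (by linarith)
  refine ⟨⟨_, bivec_attractingNull_mem_lieN hu haξ haη⟩, ?_⟩
  rw [expN_smul_repellingNull hu haξ haη rfl, hc, smul_add, smul_add, smul_smul _ ⟪a,a⟫,
    show -(-2 * c) / 2 = c by ring, haa]
  nth_rw 1 [hva]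
  module

lemma exists_eq_expA_mul_expN_mul_of_smul_attractingNull (hu : ∑ i, u i ^ 2 = 1) {g : G d} {r : ℝ}
    (hg : g • ξ = Real.exp r • ξ) : ∃ Y : lieN u, ∃ m ∈ M u, g = a[r] * expN Y * m := by
  have hfix : (a[r]⁻¹ * g) • ξ = ξ := by
    rw [mul_smul, hg, inv_smul_eq_iff, expA_smul_attractingNull hu]
  have hpair : ⟪(a[r]⁻¹ * g) • η,ξ⟫ = -2 := by
    rw [← hfix, lorentzForm_smul_smul, lorentzForm_comm,
      lorentzForm_attractingNull_repellingNull hu]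
  obtain ⟨Y, hY⟩ := exists_eq_smul_expN_smul_of_null hu (v := (a[r]⁻¹ * g) • η)
    (by rw [lorentzForm_smul_smul, lorentzForm_repellingNull_self hu]) (by rw [hpair]; norm_num)
  rw [hpair, show -(-2 : ℝ) / 2 = 1 by norm_num, one_smul] at hY
  refine ⟨Y, (expN Y)⁻¹ * (a[r]⁻¹ * g), mem_M_of_smul_null ?_ ?_, by group⟩
  · rw [mul_smul, hfix, inv_smul_eq_iff, expN_smul_attractingNull hu]
  · rw [mul_smul, hY, inv_smul_smul]

lemma exists_eq_mul_mul_expN_of_lorentzForm_neg (hu : ∑ i, u i ^ 2 = 1) {w : G d}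
    (hw : IsWeylRep u w) {g : G d} (hg : ⟪g • ξ,ξ⟫ < 0) :
    ∃ (r : ℝ) (Y₁ Y₂ : lieN u), ∃ m ∈ M u, g = a[r] * expN Y₁ * m * w * expN Y₂ := by
  rw [lorentzForm_comm, ← lorentzForm_inv_smul] at hg
  obtain ⟨Y, hY⟩ := exists_eq_smul_expN_smul_of_null hu (v := g⁻¹ • ξ)
    (by rw [lorentzForm_smul_smul, lorentzForm_attractingNull_self hu]) hg.ne
  obtain ⟨s, hs⟩ : ∃ s, -⟪g⁻¹ • ξ,ξ⟫ / 2 = Real.exp s :=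
    ⟨_, (Real.exp_log (by linarith)).symm⟩
  have hstab : (g * expN Y * w⁻¹) • ξ = Real.exp (-s) • ξ := by
    rw [Real.exp_neg, eq_inv_smul_iff₀ (Real.exp_ne_zero s), mul_smul,
      inv_smul_eq_iff.mpr (hw.smul_null hu).2.symm, mul_smul, ← smul_comm g, ← hs, ← hY,
      smul_inv_smul]
  obtain ⟨Y₁, m, hm, h⟩ := exists_eq_expA_mul_expN_mul_of_smul_attractingNull hu hstab
  refine ⟨-s, Y₁, -Y, m, hm, ?_⟩
  rw [← h, expN_neg]
  group

lemma lorentzForm_smul_repellingNull_neg (hu : ∑ i, u i ^ 2 = 1) {n : G d} (hn : n ∈ N u)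
    (hn' : n ≠ 1) : ⟪n • η,η⟫ < 0 := by
  obtain ⟨Y, rfl⟩ := exists_eq_expN hn
  obtain ⟨a, hξ, hη, hY⟩ := exists_eq_bivec_of_mem_lieN hu Y.2
  have ha : a ≠ 0 := by
    rintro rfl
    have hY0 : Y = 0 := Subtype.ext (hY.trans (by simp [bivec]))
    exact hn' (hY0 ▸ expN_zero)
  have hpos := lorentzForm_self_pos ha hξ hη
  rw [expN_smul_repellingNull hu hξ hη hY]
  simp only [map_add, map_smul, LinearMap.add_apply, LinearMap.smul_apply, hη,
    lorentzForm_repellingNull_self hu, lorentzForm_attractingNull_repellingNull hu, smul_eq_mul]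
  linarith

lemma SmoothOnG.contDiff_comp {V : Type*} [NormedAddCommGroup V] [NormedSpace ℝ V] {f : G d → V}
    (hf : SmoothOnG f) {c : ℝ → G d} (hc : ContDiff ℝ ∞ fun s => (c s : Mat d)) :
    ContDiff ℝ ∞ fun s => f (c s) := by
  refine contDiff_iff_contDiffAt.mpr fun s => ?_
  obtain ⟨U, hU, hsU, F, hF, hFf⟩ := hf (c s)
  have hnhds : U ∈ 𝓝 (c s : Mat d) := hU.mem_nhds hsU
  refine ((hF.contDiffAt hnhds).comp s hc.contDiffAt).congr_of_eventuallyEq ?_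
  filter_upwards [hc.continuous.continuousAt.preimage_mem_nhds hnhds] with r hr
  exact (hFf (c r) hr).symm

lemma contDiff_mul_expN_smul_mul (hu : ∑ i, u i ^ 2 = 1) (g h : G d) (Y : lieN u) :
    ContDiff ℝ ∞ fun s : ℝ => ((g * expN (s • Y) * h : G d) : Mat d) := by
  have hpoly (s : ℝ) : ((g * expN (s • Y) * h : G d) : Mat d) = (g : Mat d) * h +
      s • ((g : Mat d) * Y * h) + (s ^ 2 / 2) • ((g : Mat d) * (Y : Mat d) ^ 2 * h) := by
    change (g : Mat d) * (expN (s • Y) : Mat d) * h = _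
    rw [coe_expN hu, Submodule.coe_smul, smul_pow, smul_smul, one_div_mul_eq_div]
    simp only [Matrix.mul_add, Matrix.add_mul, Matrix.mul_smul, Matrix.smul_mul, Matrix.mul_one]
  rw [funext hpoly]
  exact (contDiff_const.add (contDiff_id.smul contDiff_const)).add
    (((contDiff_id.pow 2).div_const 2).smul contDiff_const)

section InducedFunctions

variable {V : Type*} [NormedAddCommGroup V] [NormedSpace ℂ V] {lam : lieA u →ₗ[ℝ] ℂ} {f : G d → V}

/-- Smooth functions on `G` with `f(anx) = a^(λ+ρ) f(x)`: the condition defining `smoothSeries`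
without the equivariance under `M`. -/
structure IsSmoothInduced (lam : lieA u →ₗ[ℝ] ℂ) (f : G d → V) : Prop where
  smooth : SmoothOnG f
  map_mul : ∀ (X : lieA u), ∀ n ∈ N u, ∀ x : G d,
    f (expA X * n * x) = Complex.exp (lam X + (rho u X : ℂ)) • f x

lemma isSmoothInduced_of_mem_smoothSeries {σ : Representation ℂ (M u) V}
    (hf : f ∈ smoothSeries σ lam) : IsSmoothInduced lam f :=
  ⟨hf.1, fun X n hn x => by simpa using hf.2 1 X n hn x⟩

/-- The number `(λ + ρ)(H₁)`, by which `λ + ρ` is determined. -/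
def exponent (lam : lieA u →ₗ[ℝ] ℂ) : ℂ := lam (H₁ u) + (rho u (H₁ u) : ℂ)

lemma IsSmoothInduced.map_expA_mul_expN_mul (hf : IsSmoothInduced lam f) (t : ℝ) (Y : lieN u)
    (x : G d) : f (a[t] * expN Y * x) = Complex.exp (exponent lam * t) • f x := by
  rw [hf.map_mul _ _ (expN_mem Y), exponent, map_smul, map_smul, smul_eq_mul, Complex.real_smul,
    Complex.ofReal_mul, ← mul_add, mul_comm]

lemma expA_smul_add (s t : ℝ) : a[s + t] = a[s] * a[t] := by rw [add_smul, expA_add]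

lemma commute_expA_of_mem_M {m : G d} (hm : m ∈ M u) (t : ℝ) : Commute m a[t] :=
  (Subgroup.mem_centralizer_iff.mp hm.1 _ ⟨_, rfl⟩).symm

lemma big_cell_mul_expA (hu : ∑ i, u i ^ 2 = 1) {w : G d} (hw : IsWeylRep u w) {m : G d}
    (hm : m ∈ M u) (r t : ℝ) (Y₁ Y₂ : lieN u) :
    a[r] * expN Y₁ * m * w * expN Y₂ * a[t] =
      a[r - t] * expN (Real.exp t • Y₁) * (m * w * expN (Real.exp (-t) • Y₂)) := by
  have hnull := hw.smul_null hu
  calc a[r] * expN Y₁ * m * w * expN Y₂ * a[t]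
      = a[r] * expN Y₁ * m * (w * a[t]) * expN (Real.exp (-t) • Y₂) := by
        rw [mul_assoc, expN_mul_expA hu]; group
    _ = a[r] * expN Y₁ * (m * a[-t]) * w * expN (Real.exp (-t) • Y₂) := by
        rw [mul_expA_of_swap_null hnull.1 hnull.2]; group
    _ = a[r] * (expN Y₁ * a[-t]) * m * w * expN (Real.exp (-t) • Y₂) := by
        rw [commute_expA_of_mem_M hm]; group
    _ = a[r - t] * expN (Real.exp t • Y₁) * (m * w * expN (Real.exp (-t) • Y₂)) := by
        rw [expN_mul_expA hu, neg_neg, sub_eq_add_neg, expA_smul_add]; group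

lemma IsSmoothInduced.isExpSmooth_mul_expA_mul (hf : IsSmoothInduced lam f)
    (hu : ∑ i, u i ^ 2 = 1) {w : G d} (hw : IsWeylRep u w) {g : G d} (hg : ⟪g • ξ,ξ⟫ < 0)
    (h : G d) :
    IsExpSmooth (-exponent lam) (-1) fun t => f (g * a[t] * h) := by
  obtain ⟨r, Y₁, Y₂, m, hm, rfl⟩ := exists_eq_mul_mul_expN_of_lorentzForm_neg hu hw hg
  refine ⟨fun s => Complex.exp (exponent lam * r) • f (m * w * expN (s • Y₂) * h),
    (hf.smooth.contDiff_comp (contDiff_mul_expN_smul_mul hu _ _ _)).const_smul _,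
    funext fun t => ?_⟩
  rw [big_cell_mul_expA hu hw hm, mul_assoc, hf.map_expA_mul_expN_mul, smul_smul,
    ← Complex.exp_add, neg_one_mul]
  congr 2
  push_cast
  ring

lemma IsSmoothInduced.hasExpTails (hf : IsSmoothInduced lam f) (hu : ∑ i, u i ^ 2 = 1) {w n : G d}
    (hw : IsWeylRep u w) (hn : n ∈ N u) (hn' : n ≠ 1) :
    HasExpTails (exponent lam) fun t => f (w * n * a[t]) := by
  obtain ⟨hwξ, hwη⟩ := hw.smul_null hu
  have htop : ⟪(w * n) • ξ,ξ⟫ < 0 := by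
    obtain ⟨Y, rfl⟩ := exists_eq_expN hn
    rw [mul_smul, expN_smul_attractingNull hu, hwξ, lorentzForm_comm,
      lorentzForm_attractingNull_repellingNull hu]
    norm_num
  have hbot : ⟪(w * n * w⁻¹) • ξ,ξ⟫ < 0 := by
    nth_rw 2 [← hwη]
    rw [mul_smul, inv_smul_eq_iff.mpr hwη.symm, mul_smul, lorentzForm_smul_smul]
    exact lorentzForm_smul_repellingNull_neg hu hn hn'
  refine ⟨by simpa only [mul_one] using hf.isExpSmooth_mul_expA_mul hu hw htop 1, ?_⟩
  have hreflect (t : ℝ) : w * n * a[t] = w * n * w⁻¹ * a[-t] * w := by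
    rw [mul_assoc _ a[-t], ← mul_expA_of_swap_null hwξ hwη]
    group
  simpa only [hreflect, neg_neg] using (hf.isExpSmooth_mul_expA_mul hu hw hbot w).comp_neg

end InducedFunctions

lemma rho_H₁_pos [Nontrivial (lieN u)] : 0 < rho u (H₁ u) := by
  have had : adN u (H₁ u) = 1 := LinearMap.ext fun Y => Subtype.ext Y.2.2
  have hdim : 0 < Module.finrank ℝ (lieN u) := Module.finrank_pos
  rw [rho, LinearMap.smul_apply, LinearMap.comp_apply, had, LinearMap.trace_one, smul_eq_mul]
  positivity

lemma exponent_re_pos [Nontrivial (lieN u)] {lam : lieA u →ₗ[ℝ] ℂ}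
    (hlam : PosOnA u (Complex.reLm ∘ₗ lam + rho u)) : 0 < (exponent lam).re := by
  obtain ⟨t, ht, h⟩ := hlam
  have hre : (exponent lam).re = t * rho u (H₁ u) := LinearMap.congr_fun h (H₁ u)
  rw [hre]
  exact mul_pos ht rho_H₁_pos

lemma nontrivial_lieN {n : G d} (hn : n ∈ N u) (hn' : n ≠ 1) : Nontrivial (lieN u) := by
  obtain ⟨Y, rfl⟩ := exists_eq_expN hn
  exact ⟨Y, 0, fun h => hn' (h ▸ expN_zero)⟩

section Integrand

variable {V : Type*} [NormedAddCommGroup V] [NormedSpace ℂ V]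

lemma exists_forall_apply_smul_H₁ {lamγ : lieA u →ₗ[ℝ] ℂ} {Xγ : lieA u}
    (hlamγ : lamγ Xγ = 2 * (Real.pi : ℂ) * Complex.I) :
    ∃ c : ℝ, c ≠ 0 ∧ ∀ t : ℝ, lamγ (t • H₁ u) = 2 * Real.pi * Complex.I * (t * c : ℝ) := by
  obtain ⟨r, rfl⟩ := exists_eq_smul_H₁ Xγ
  have hr : r ≠ 0 := by
    rintro rfl
    rw [zero_smul, map_zero] at hlamγ
    exact Complex.two_pi_I_ne_zero hlamγ.symm
  refine ⟨r⁻¹, inv_ne_zero hr, fun t => ?_⟩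
  have ht : t • H₁ u = (t * r⁻¹) • r • H₁ u := by rw [smul_smul, inv_mul_cancel_right₀ hr]
  rw [ht, map_smul, hlamγ, Complex.real_smul, mul_comm]

lemma integrand_eq_fourierChar_smul {lamγ : lieA u →ₗ[ℝ] ℂ} {c : ℝ}
    (hc : ∀ t : ℝ, lamγ (t • H₁ u) = 2 * Real.pi * Complex.I * (t * c : ℝ)) (w n : G d) (k : ℤ)
    (l : Module.Dual ℂ V) (f : G d → V) :
    integrand lamγ w n k l f = fun t => 𝐞 (-(t * (k * c))) • l (f (w * n * a[t])) := by
  funext t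
  rw [integrand, hc, Circle.smul_def, Real.fourierChar_apply, smul_eq_mul, mul_comm]
  congr 2
  push_cast
  ring

end Integrand

end HypFourier

end

open HypFourier in
theorem mainTheorem6_general {d : ℕ} {u : Fin d → ℝ} (hu : ∑ i, u i ^ 2 = 1)
    {Xγ : lieA u} {lamγ : lieA u →ₗ[ℝ] ℂ} (hlamγ : lamγ Xγ = 2 * (Real.pi : ℂ) * Complex.I)
    {w₀ : G d} (hw₀ : IsWeylRep u w₀) {n₀ : G d} (hn₀ : n₀ ∈ N u) (hn₀' : n₀ ≠ 1)
    {V : Type*} [NormedAddCommGroup V] [NormedSpace ℂ V] {lam : lieA u →ₗ[ℝ] ℂ}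
    (hlam : PosOnA u (Complex.reLm ∘ₗ lam + rho u)) {l : Module.Dual ℂ V} (hl : Continuous l)
    {f : G d → V} (hf : IsSmoothInduced lam f) :
    (∀ k : ℤ, MeasureTheory.Integrable (integrand lamγ w₀ n₀ k l f)) ∧
      RapidlyDecreasing fun k : ℤ => I lamγ w₀ n₀ k l f := by
  have : Nontrivial (lieN u) := nontrivial_lieN hn₀ hn₀'
  have hz : 0 < (exponent lam).re := exponent_re_pos hlam
  have htails : HasExpTails (exponent lam) fun t => l (f (w₀ * n₀ * expA (t • H₁ u))) :=
    (hf.hasExpTails hu hw₀ hn₀ hn₀').clm_comp ⟨l, hl⟩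
  obtain ⟨c, hc, hlamγ_c⟩ := exists_forall_apply_smul_H₁ hlamγ
  have hintegrand (k : ℤ) := integrand_eq_fourierChar_smul hlamγ_c w₀ n₀ k l f
  refine ⟨fun k => ?_, ?_⟩
  · rw [hintegrand]
    exact integrable_fourierChar_smul (htails.integrable hz) _
  · simpa only [I, hintegrand, Real.fourier_real_eq] using htails.rapidlyDecreasing_fourier hz hc

theorem mainTheorem6 {d : ℕ} (hd : 2 ≤ d)
    (u : Fin d → ℝ) (hu : ∑ i, u i ^ 2 = 1)
    (γ x : HypFourier.G d) (Xγ : HypFourier.lieA u) (mγ : HypFourier.M u)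
    (hγ : γ = x * (HypFourier.expA Xγ * mγ) * x⁻¹) (hXγ : HypFourier.expA Xγ ≠ 1)
    (lamγ : HypFourier.lieA u →ₗ[ℝ] ℂ)
    (hlamγ : lamγ Xγ = 2 * (Real.pi : ℂ) * Complex.I)
    (w₀ : HypFourier.G d) (hw₀ : HypFourier.IsWeylRep u w₀)
    (n₀ : HypFourier.G d) (hn₀ : n₀ ∈ HypFourier.N u) (hn₀' : n₀ ≠ 1)
    {V : Type*} [NormedAddCommGroup V] [NormedSpace ℂ V] [FiniteDimensional ℂ V]
    (σ : Representation ℂ (HypFourier.M u) V) (hσ : σ.IsIrreducible)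
    (hσc : ∀ v : V, Continuous fun m : HypFourier.M u => σ m v)
    (lam : HypFourier.lieA u →ₗ[ℝ] ℂ)
    (hlam : HypFourier.PosOnA u (Complex.reLm ∘ₗ lam + HypFourier.rho u))
    (l : Module.Dual ℂ V) (f : HypFourier.G d → V) (hf : f ∈ HypFourier.smoothSeriesM σ lam) :
    (∀ k : ℤ, MeasureTheory.Integrable (HypFourier.integrand lamγ w₀ n₀ k l f)) ∧
      HypFourier.RapidlyDecreasing fun k : ℤ => HypFourier.I lamγ w₀ n₀ k l f := by
  exact mainTheorem6_general hu hlamγ hw₀ hn₀ hn₀' hlam l.continuous_of_finiteDimensional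
    (HypFourier.isSmoothInduced_of_mem_smoothSeries hf.1)
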